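/- Let $n,k,\ell,d$ be non-negative integers and let $A$ be an $\ell\times k$ matrix whose entries are homogeneous polynomials of the same degree $d$ in $\mathbb{C}[\partial_1,\dots,\partial_n]$. For $y\in\mathbb{P}^{n-1}$ let $A(y)$ be the complex $\ell\times k$ matrix, well defined up to scale, obtained by replacing each $\partial_i$ by $y_i$, and regard $\ker A(y)$ as a linear subspace of $\mathbb{P}^{k-1}$; all projective spaces are over $\mathbb{C}$. Let $\mathrm{Gr}(m,n)$ be the Grassmannian of $m$-dimensional linear subspaces of $\mathbb{C}^n$, i.e. of $(m-1)$-dimensional linear subspaces of $\mathbb{P}^{n-1}$. Define $$\mathcal{W}^r_A=\bigcup_{\pi\in\mathrm{Gr}(n-r,n)}\ \bigcap_{y\in\pi}\ker A(y)\quad(0\le r\le n-1),\qquad \mathcal{O}^r_A=\bigcap_{\sigma\in\mathrm{Gr}(r,n)}\ \bigcup_{y\in\sigma}\ker A(y)\quad(1\le r\le n),$$ where $y$ runs over points of $\mathbb{P}^{n-1}$. For $1\le m\le n$ put $$\mathcal{I}_{A,m}=\{(y,z,\pi)\in\mathbb{P}^{n-1}\times\mathbb{P}^{k-1}\times\mathrm{Gr}(m,n)\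 :\ A(y)z=0\ \text{and}\ y\in\pi\}.$$ Then: 1. For every $r\in\{0,\dots,n-1\}$, the set $\mathcal{W}^r_A$ is Zariski closed in $\mathbb{P}^{k-1}$, i.e. it is the set of common zeros of finitely many homogeneous polynomials in $k$ variables. 2. For every $r\in\{1,\dots,n\}$, the set $\mathcal{O}^r_A$ is Zariski closed in $\mathbb{P}^{k-1}$, in the same sense. 3. For every $m\in\{1,\dots,n\}$, $\mathcal{I}_{A,m}$ is closed in $\mathbb{P}^{n-1}\times\mathbb{P}^{k-1}\times\mathrm{Gr}(m,n)$: it is cut out by finitely many polynomials in the coordinates $y$, the coordinates $z$ and the Plücker coordinates $p$ of $\pi$ that are homogeneous in each of these three groups of variables. 4. The sets $\mathcal{W}^r_A$ and $\mathcal{O}^r_A$ arise from these incidence varieties by quantifier elimination: $$\mathcal{W}^r_A=\{z:\ \exists\,\pi\in\mathrm{Gr}(n-r,n)\ \ \forall\, y\in\pi:\ (y,z,\pi)\in\mathcal{I}_{A,n-r}\}\quad(0\le r\le n-1),$$ $$\mathcal{O}^r_A=\{z:\ \forall\,\sigma\in\mathrm{Gr}(r,n)\ \ \exists\, y\in\mathbb{P}^{n-1}:\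 (y,z,\sigma)\in\mathcal{I}_{A,r}\}\quad(1\le r\le n).$$ -/

import Mathlib

namespace WaveVar

/-- `ProjPt n` is the complex projective space of dimension `n - 1`, with homogeneous coordinates
indexed by `Fin n`. -/
abbrev ProjPt (n : ℕ) : Type := Projectivization ℂ (Fin n → ℂ)

/-- The Grassmannian of `m`-dimensional linear subspaces of `ℂ ^ n`. -/
abbrev Gr (m n : ℕ) : Type := {π : Submodule ℂ (Fin n → ℂ) // Module.finrank ℂ π = m}

/-- The projective linear subspace defined by a linear subspace of `ℂ ^ n`: the set of its
lines. -/
def points {n : ℕ} (π : Submodule ℂ (Fin n → ℂ)) : Set (ProjPt n) :=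
  {y | y.submodule ≤ π}

theorem mk_mem_points {n : ℕ} (π : Submodule ℂ (Fin n → ℂ)) (v : Fin n → ℂ) (hv : v ≠ 0) :
    Projectivization.mk ℂ v hv ∈ points π ↔ v ∈ π := by
  simp [points, Submodule.span_singleton_le_iff_mem]

/-- A matrix with entries in `ℂ[∂₁, …, ∂ₙ]`. -/
abbrev PolyMatrix (l k n : ℕ) : Type := Matrix (Fin l) (Fin k) (MvPolynomial (Fin n) ℂ)

/-- The complex matrix `A(v)`, obtained by replacing each variable by a coordinate of `v`. -/
noncomputable def evalAt {l k n : ℕ} (A : PolyMatrix l k n) (v : Fin n → ℂ) : Matrix (Fin l) (Fin k) ℂ :=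
  A.map (MvPolynomial.eval v)

/-- `ker A(y)`, as a linear subspace of projective space. If all entries of `A` are homogeneous of
the same degree, it does not depend on the homogeneous coordinates chosen for `y`;
see `mk_mem_kerAt_mk`. -/
noncomputable def kerAt {l k n : ℕ} (A : PolyMatrix l k n) (y : ProjPt n) : Set (ProjPt k) :=
  points (LinearMap.ker (Matrix.toLin' (evalAt A y.rep)))

theorem evalAt_smul {l k n d : ℕ} (A : PolyMatrix l k n) (hA : ∀ i j, (A i j).IsHomogeneous d)
    (c : ℂ) (v : Fin n → ℂ) : evalAt A (c • v) = c ^ d • evalAt A v := by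
  ext i j
  simp only [evalAt, Matrix.map_apply, Matrix.smul_apply, smul_eq_mul]
  rw [MvPolynomial.eval_eq', MvPolynomial.eval_eq', Finset.mul_sum]
  refine Finset.sum_congr rfl fun e he => ?_
  have hd : ∑ t, e t = d := by
    have := hA i j (MvPolynomial.mem_support_iff.mp he)
    rw [Finsupp.weight_apply, Finsupp.sum_fintype _ _ (by simp)] at this
    simpa using this
  simp only [Pi.smul_apply, smul_eq_mul, mul_pow, Finset.prod_mul_distrib]
  rw [Finset.prod_pow_eq_pow_sum, hd]
  ring

theorem mk_mem_kerAt_mk {l k n d : ℕ} (A : PolyMatrix l k n)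
    (hA : ∀ i j, (A i j).IsHomogeneous d) (v : Fin n → ℂ) (hv : v ≠ 0)
    (w : Fin k → ℂ) (hw : w ≠ 0) :
    Projectivization.mk ℂ w hw ∈ kerAt A (Projectivization.mk ℂ v hv) ↔
      (evalAt A v).mulVec w = 0 := by
  obtain ⟨a, ha⟩ := Projectivization.exists_smul_eq_mk_rep ℂ v hv
  rw [kerAt, mk_mem_points, ← ha, Units.smul_def, evalAt_smul A hA, LinearMap.mem_ker,
    Matrix.toLin'_apply, Matrix.smul_mulVec, smul_eq_zero]
  simp

/-- The level `r` wave variety. -/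
def waveVariety {l k n : ℕ} (A : PolyMatrix l k n) (r : ℕ) : Set (ProjPt k) :=
  ⋃ π : Gr (n - r) n, ⋂ y ∈ points π.1, kerAt A y

/-- The level `r` obstruction variety. -/
def obstructionVariety {l k n : ℕ} (A : PolyMatrix l k n) (r : ℕ) : Set (ProjPt k) :=
  ⋂ σ : Gr r n, ⋃ y ∈ points σ.1, kerAt A y

/-- The incidence variety of all `(y, z, π)` with `A(y) z = 0` and `y ∈ π`, where `π` runs over
the Grassmannian of `m`-dimensional linear subspaces. -/
def incidence {l k n : ℕ} (A : PolyMatrix l k n) (m : ℕ) : Set (ProjPt n × ProjPt k × Gr m n) :=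
  {x | x.2.1 ∈ kerAt A x.1 ∧ x.1 ∈ points x.2.2.1}

/-- The set `X` is a (Zariski closed, possibly reducible or empty) projective variety: the set of
common zeros of finitely many homogeneous polynomials. -/
def IsProjectiveVariety {k : ℕ} (X : Set (ProjPt k)) : Prop :=
  ∃ F : Set (MvPolynomial (Fin k) ℂ), F.Finite ∧ (∀ f ∈ F, ∃ e, f.IsHomogeneous e) ∧
    ∀ (v : Fin k → ℂ) (hv : v ≠ 0),
      Projectivization.mk ℂ v hv ∈ X ↔ ∀ f ∈ F, MvPolynomial.eval v f = 0

/-- `p` is a vector of Plücker coordinates of `π`: the vector of maximal minors of a matrix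
whose rows are a basis of `π`. The index sets `I` are written as increasing maps. -/
def IsPlucker {m n : ℕ} (π : Gr m n) (p : (Fin m ↪o Fin n) → ℂ) : Prop :=
  ∃ S : Matrix (Fin m) (Fin n) ℂ, Submodule.span ℂ (Set.range S) = π.1 ∧
    ∀ I : Fin m ↪o Fin n, p I = (S.submatrix id I).det

/-- The weights that define the tridegree of a polynomial in three groups of variables. -/
def triWeight {α β γ : Type} : α ⊕ β ⊕ γ → ℕ × ℕ × ℕ :=
  Sum.elim (fun _ => (1, 0, 0)) (Sum.elim (fun _ => (0, 1, 0)) (fun _ => (0, 0, 1)))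

/-- `X` is a closed subvariety of the product of two projective spaces and a Grassmannian in
its Plücker embedding: it is the set of common zeros of finitely many polynomials in the coordinates
`(y, z, p)` that are homogeneous in each of the three groups of variables. -/
def IsTriprojectiveVariety {n k m : ℕ} (X : Set (ProjPt n × ProjPt k × Gr m n)) : Prop :=
  ∃ F : Set (MvPolynomial (Fin n ⊕ Fin k ⊕ (Fin m ↪o Fin n)) ℂ), F.Finite ∧
    (∀ f ∈ F, ∃ e : ℕ × ℕ × ℕ, f.IsWeightedHomogeneous triWeight e) ∧
    ∀ (v : Fin n → ℂ) (hv : v ≠ 0) (w : Fin k → ℂ) (hw : w ≠ 0) (π : Gr m n)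
      (p : (Fin m ↪o Fin n) → ℂ), IsPlucker π p →
      ((Projectivization.mk ℂ v hv, Projectivization.mk ℂ w hw, π) ∈ X ↔
        ∀ f ∈ F, MvPolynomial.eval (Sum.elim v (Sum.elim w p)) f = 0)

end WaveVar

open MvPolynomial

/-! Closedness of both varieties is elimination theory. Homogeneous equations have no nonzero
solution exactly when, in some degree `N`, their monomial multiples span all forms; so solvability
means that all maximal minors of coefficient matrices vanish, and minors are polynomials in the
parameters (`exists_eliminants`). For a fixed `σ`, a basis turns the union over `y ∈ σ` into such a
problem; the obstruction variety intersects these over all `σ`. For the wave variety, `π` is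
replaced by a nonzero array `t`, with no Plücker relations imposed: the contractions of any `t ≠ 0`
contain an `m`-dimensional space, while those of the array of minors of `π` stay in `π`. Hence some
`π` works iff `A` at every contraction of some `t ≠ 0` kills `z`. Incidence is cut out by `A(y) z =
0` and by the minors expressing `y ∈ π`. -/

theorem exists_det_ne_zero_of_span_eq_top {K M ρ : Type*} [Field K] [Fintype M] [DecidableEq M]
    (v : ρ → M → K) (hv : Submodule.span K (Set.range v) = ⊤) :
    ∃ φ : M → ρ, (Matrix.of fun i => v (φ i)).det ≠ 0 := by
  obtain ⟨κ, a, -, hspan, hli⟩ := exists_linearIndependent' K v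
  let b := Module.Basis.mk hli (by rw [hspan, hv])
  let e : M ≃ κ := (Pi.basisFun K M).indexEquiv b
  refine ⟨a ∘ e, ?_⟩
  have h : LinearIndependent K (Matrix.of fun i => v ((a ∘ e) i)).row :=
    hli.comp e e.injective
  exact ((Matrix.isUnit_iff_isUnit_det _).mp
    (Matrix.linearIndependent_rows_iff_isUnit.mp h)).ne_zero

/-! ### Elimination theory over an algebraically closed field -/

namespace MvPolynomial

variable {K τ κ ι : Type*} [Field K] [Fintype τ]

/-- By the Nullstellensatz every variable lies in the radical, and in a noetherian ring some power
of the radical lies in the ideal. -/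
theorem exists_pow_idealOfVars_le [IsAlgClosed K] (g : ι → MvPolynomial τ K)
    (hg : ∀ t : τ → K, (∀ i, eval t (g i) = 0) → t = 0) :
    ∃ N, idealOfVars τ K ^ N ≤ Ideal.span (Set.range g) := by
  obtain ⟨N, hN⟩ := Ideal.exists_radical_pow_le_of_fg (Ideal.span (Set.range g))
    (IsNoetherian.noetherian _)
  refine ⟨N, (Ideal.pow_right_mono ?_ N).trans hN⟩
  rw [← vanishingIdeal_zeroLocus_eq_radical (K := K), zeroLocus_span, idealOfVars, Ideal.span_le]
  rintro _ ⟨s, rfl⟩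
  rw [SetLike.mem_coe, mem_vanishingIdeal_iff]
  intro t ht
  have : t = 0 := hg t fun i => by simpa [aeval_eq_eval] using ht (g i) ⟨i, rfl⟩
  simp [this]

variable [DecidableEq τ]

/-- The vector of coefficients in degree `N` of a polynomial. -/
noncomputable def degreeCoeffs (K τ : Type*) [CommRing K] [Fintype τ] [DecidableEq τ] (N : ℕ) :
    MvPolynomial τ K →ₗ[K] (Finset.finsuppAntidiag (Finset.univ : Finset τ) N → K) :=
  LinearMap.pi fun e => lcoeff K e.1

theorem degreeCoeffs_apply {R : Type*} [CommRing R] (N : ℕ) (p : MvPolynomial τ R)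
    (e : Finset.finsuppAntidiag (Finset.univ : Finset τ) N) :
    degreeCoeffs R τ N p e = coeff e.1 p := rfl

theorem sum_degreeCoeffs_mul (N : ℕ) (p : MvPolynomial τ K) (t : τ → K) :
    ∑ e, degreeCoeffs K τ N p e * ∏ i, t i ^ e.1 i = eval t (homogeneousComponent N p) := by
  have hdeg : ∀ e : τ →₀ ℕ, e ∈ Finset.finsuppAntidiag (Finset.univ : Finset τ) N ↔
      e.degree = N := fun e => by simp [Finset.mem_finsuppAntidiag, Finsupp.degree_eq_sum]
  have hcoeff : ∀ e : Finset.finsuppAntidiag (Finset.univ : Finset τ) N,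
      degreeCoeffs K τ N p e = coeff e.1 (homogeneousComponent N p) := fun e => by
    rw [degreeCoeffs_apply, coeff_homogeneousComponent, if_pos ((hdeg e.1).mp e.2)]
  simp only [hcoeff]
  generalize hq : homogeneousComponent N p = q
  rw [eval_eq']
  refine (Finset.sum_coe_sort (Finset.finsuppAntidiag (Finset.univ : Finset τ) N)
    fun e => coeff e q * ∏ i, t i ^ e i).trans (Finset.sum_subset ?_ ?_).symm
  · intro e he
    rw [← hq, mem_support_iff, coeff_homogeneousComponent] at he
    rw [hdeg]
    by_contra h
    exact he (if_neg h)
  · intro e _ he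
    rw [notMem_support_iff.mp he, zero_mul]

theorem degreeCoeffs_mem_span (g : ι → MvPolynomial τ K) (N : ℕ) {p : MvPolynomial τ K}
    (hp : p ∈ Ideal.span (Set.range g)) :
    degreeCoeffs K τ N p ∈ Submodule.span K
      (Set.range fun x : (τ →₀ ℕ) × ι => degreeCoeffs K τ N (monomial x.1 1 * g x.2)) := by
  -- The extra factor `q` lets the induction absorb multiplication by ring elements, although the
  -- target is only a `K`-subspace.
  suffices h : ∀ q, degreeCoeffs K τ N (q * p) ∈ Submodule.span K
      (Set.range fun x : (τ →₀ ℕ) × ι => degreeCoeffs K τ N (monomial x.1 1 * g x.2)) by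
    simpa using h 1
  induction hp using Submodule.span_induction with
  | mem x hx =>
    obtain ⟨i, rfl⟩ := hx
    intro q
    induction q using MvPolynomial.induction_on' with
    | monomial a c =>
      have : monomial a c * g i = c • (monomial a 1 * g i) := by
        rw [← smul_mul_assoc, smul_monomial, smul_eq_mul, mul_one]
      rw [this, map_smul]
      exact Submodule.smul_mem _ _ (Submodule.subset_span ⟨(a, i), rfl⟩)
    | add p q hp hq => rw [add_mul, map_add]; exact Submodule.add_mem _ hp hq
  | zero => simp
  | add x y _ _ hx hy => intro q; rw [mul_add, map_add]; exact Submodule.add_mem _ (hx q) (hy q)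
  | smul a x _ hx => intro q; rw [smul_eq_mul, ← mul_assoc]; exact hx _

/-- The projective Nullstellensatz in terms of maximal minors. -/
theorem exists_ne_zero_eval_eq_zero_iff [IsAlgClosed K] (g : ι → MvPolynomial τ K) (d : ι → ℕ)
    (hd : ∀ i, (g i).IsHomogeneous (d i)) :
    (∃ t : τ → K, t ≠ 0 ∧ ∀ i, eval t (g i) = 0) ↔
      ∀ (N : ℕ) (φ : Finset.finsuppAntidiag (Finset.univ : Finset τ) N → (τ →₀ ℕ) × ι),
        (Matrix.of fun e => degreeCoeffs K τ N (monomial (φ e).1 1 * g (φ e).2)).det = 0 := by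
  constructor
  · rintro ⟨t, ht, h⟩ N φ
    rw [← Matrix.exists_mulVec_eq_zero_iff]
    obtain ⟨s, hs⟩ := Function.ne_iff.mp ht
    -- The values at `t` of all monomials of degree `N` form a kernel vector; it is nonzero at the
    -- `N`-th power of a variable with `t s ≠ 0`.
    refine ⟨fun e => ∏ i, t i ^ e.1 i, Function.ne_iff.mpr
      ⟨⟨Finsupp.single s N, by simp [Finset.mem_finsuppAntidiag]⟩, ?_⟩, ?_⟩
    · simp only [Pi.zero_apply]
      rw [Finset.prod_ne_zero_iff]
      intro i _
      by_cases hi : i = s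
      · subst hi; exact pow_ne_zero _ hs
      · simp [Ne.symm hi]
    · funext e
      change ∑ e', degreeCoeffs K τ N (monomial (φ e).1 1 * g (φ e).2) e' * ∏ i, t i ^ e'.1 i = 0
      rw [sum_degreeCoeffs_mul]
      have hh : (monomial (φ e).1 (1 : K) * g (φ e).2).IsHomogeneous
          ((φ e).1.degree + d (φ e).2) := (isHomogeneous_monomial _ rfl).mul (hd _)
      rw [homogeneousComponent_of_mem ((mem_homogeneousSubmodule _ _).mpr hh)]
      split_ifs <;> simp [h]
  · intro H
    by_contra! hc
    obtain ⟨N, hN⟩ := exists_pow_idealOfVars_le g fun t ht => by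
      by_contra h0
      obtain ⟨i, hi⟩ := hc t h0
      exact hi (ht i)
    obtain ⟨φ, hφ⟩ := exists_det_ne_zero_of_span_eq_top
      (fun x : (τ →₀ ℕ) × ι => degreeCoeffs K τ N (monomial x.1 1 * g x.2)) (by
        rw [eq_top_iff, ← (Pi.basisFun K _).span_eq, Submodule.span_le]
        rintro _ ⟨e, rfl⟩
        have he : Pi.basisFun K _ e = degreeCoeffs K τ N (monomial e.1 1) := by
          funext e'
          rw [degreeCoeffs_apply, coeff_monomial, Pi.basisFun_apply, Pi.single_apply]
          exact if_congr (by rw [Subtype.ext_iff, eq_comm]) rfl rfl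
        rw [he]
        refine degreeCoeffs_mem_span g N (hN ?_)
        rw [monomial_mem_pow_idealOfVars_iff _ _ one_ne_zero]
        have he' := e.2
        rw [Finset.mem_finsuppAntidiag] at he'
        rw [Finsupp.degree_eq_sum, he'.1])
    exact hφ (H N φ)

/-- The main theorem of elimination theory. -/
theorem exists_eliminants [IsAlgClosed K] (f : ι → MvPolynomial τ (MvPolynomial κ K)) (d : ι → ℕ)
    (hd : ∀ i, (f i).IsHomogeneous (d i)) :
    ∃ G : Set (MvPolynomial κ K), ∀ z : κ → K,
      (∃ t : τ → K, t ≠ 0 ∧ ∀ i, eval t (map (eval z) (f i)) = 0) ↔ ∀ g ∈ G, eval z g = 0 := by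
  refine ⟨{g | ∃ (N : ℕ) (φ : Finset.finsuppAntidiag (Finset.univ : Finset τ) N → (τ →₀ ℕ) × ι),
    g = (Matrix.of fun e => degreeCoeffs (MvPolynomial κ K) τ N
      (monomial (φ e).1 1 * f (φ e).2)).det}, fun z => ?_⟩
  rw [exists_ne_zero_eval_eq_zero_iff _ d fun i => (hd i).map _]
  -- Taking minors commutes with specializing the parameters to `z`.
  have key : ∀ (N : ℕ) (φ : Finset.finsuppAntidiag (Finset.univ : Finset τ) N → (τ →₀ ℕ) × ι),
      eval z (Matrix.of fun e => degreeCoeffs (MvPolynomial κ K) τ N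
        (monomial (φ e).1 1 * f (φ e).2)).det = (Matrix.of fun e => degreeCoeffs K τ N
        (monomial (φ e).1 1 * map (eval z) (f (φ e).2))).det := by
    intro N φ
    rw [RingHom.map_det]
    congr 1
    ext e e'
    simp [degreeCoeffs_apply, ← coeff_map]
  constructor
  · rintro h _ ⟨N, φ, rfl⟩
    rw [key, h]
  · intro h N φ
    rw [← key]
    exact h _ ⟨N, φ, rfl⟩

end MvPolynomial

/-! ### Projective varieties and elimination of a point -/

namespace WaveVar

theorem eval_smul_of_isHomogeneous {κ : Type*} {f : MvPolynomial κ ℂ} {e : ℕ}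
    (hf : f.IsHomogeneous e) (c : ℂ) (v : κ → ℂ) : eval (c • v) f = c ^ e * eval v f := by
  rw [eval_eq, eval_eq, Finset.mul_sum]
  refine Finset.sum_congr rfl fun a ha => ?_
  have ha' : ∑ t ∈ a.support, a t = e := (hf.degree_eq_sum_deg_support ha).symm
  simp only [Pi.smul_apply, smul_eq_mul, mul_pow, Finset.prod_mul_distrib]
  rw [Finset.prod_pow_eq_pow_sum, ha']
  ring

/-- The values of the components at `v` are the coefficients of `c ↦ f (c • v)`, a polynomial with
infinitely many roots. -/
theorem eval_homogeneousComponent_eq_zero {κ : Type*} {f : MvPolynomial κ ℂ} {v : κ → ℂ}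
    (h : ∀ c : ℂ, c ≠ 0 → eval (c • v) f = 0) (e : ℕ) :
    eval v (homogeneousComponent e f) = 0 := by
  let P : Polynomial ℂ :=
    ∑ i ∈ Finset.range (f.totalDegree + 1), Polynomial.monomial i (eval v (homogeneousComponent i f))
  have hP : ∀ c, P.eval c = eval (c • v) f := by
    intro c
    conv_rhs => rw [← sum_homogeneousComponent f, map_sum]
    simp only [P, Polynomial.eval_finsetSum, Polynomial.eval_monomial]
    refine Finset.sum_congr rfl fun i _ => ?_
    rw [eval_smul_of_isHomogeneous (homogeneousComponent_isHomogeneous i f), mul_comm]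
  have h0 : P = 0 := by
    refine Polynomial.eq_zero_of_infinite_isRoot _
      (Set.Infinite.mono (s := {(0 : ℂ)}ᶜ) (fun c hc => ?_) (Set.finite_singleton _).infinite_compl)
    exact (hP c).trans (h c hc)
  rcases lt_or_ge f.totalDegree e with he | he
  · rw [homogeneousComponent_eq_zero _ _ he, map_zero]
  · have := congrArg (Polynomial.coeff · e) h0
    simpa [P, Polynomial.coeff_monomial, Nat.lt_succ_iff, he] using this

/-- Finiteness is free: by Hilbert's basis theorem a finite subset of `G` generates the same ideal.
-/
theorem IsProjectiveVariety.of_homogeneous {k : ℕ} {X : Set (ProjPt k)}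
    (G : Set (MvPolynomial (Fin k) ℂ)) (hG : ∀ g ∈ G, ∃ e, g.IsHomogeneous e)
    (h : ∀ (v : Fin k → ℂ) (hv : v ≠ 0),
      Projectivization.mk ℂ v hv ∈ X ↔ ∀ g ∈ G, eval v g = 0) : IsProjectiveVariety X := by
  obtain ⟨F, hFG, hF⟩ := (Submodule.fg_span_iff_fg_span_finset_subset G).mp
    (IsNoetherian.noetherian (Submodule.span (MvPolynomial (Fin k) ℂ) G))
  refine ⟨F, F.finite_toSet, fun f hf => hG f (hFG hf), fun v hv => ?_⟩
  rw [h]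
  refine ⟨fun H f hf => H f (hFG hf), fun H g hg => ?_⟩
  have hle : Ideal.span (F : Set (MvPolynomial (Fin k) ℂ)) ≤ RingHom.ker (eval v) :=
    Ideal.span_le.mpr fun f hf => H f hf
  exact hle (show g ∈ Submodule.span _ _ from hF ▸ Submodule.subset_span hg)

/-- Homogeneity is free too: the zero set is stable under scaling, so each equation may be split
into its components. -/
theorem IsProjectiveVariety.of_forall_eval_eq_zero {k : ℕ} {X : Set (ProjPt k)}
    (G : Set (MvPolynomial (Fin k) ℂ))
    (h : ∀ (v : Fin k → ℂ) (hv : v ≠ 0),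
      Projectivization.mk ℂ v hv ∈ X ↔ ∀ g ∈ G, eval v g = 0) : IsProjectiveVariety X := by
  refine .of_homogeneous {f | ∃ g ∈ G, ∃ e, f = homogeneousComponent e g} ?_ fun v hv => ?_
  · rintro _ ⟨g, -, e, rfl⟩
    exact ⟨e, homogeneousComponent_isHomogeneous e g⟩
  · constructor
    · rintro H _ ⟨g, hg, e, rfl⟩
      refine eval_homogeneousComponent_eq_zero (fun c hc => ?_) e
      refine (h (c • v) (smul_ne_zero hc hv)).mp ?_ g hg
      rwa [show Projectivization.mk ℂ (c • v) (smul_ne_zero hc hv) = Projectivization.mk ℂ v hv from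
        (Projectivization.mk_eq_mk_iff' ..).mpr ⟨c, rfl⟩]
    · intro H
      rw [h]
      intro g hg
      rw [← sum_homogeneousComponent g, map_sum]
      exact Finset.sum_eq_zero fun e _ => H _ ⟨g, hg, e, rfl⟩

theorem IsProjectiveVariety.iInter {k : ℕ} {ι : Sort*} {X : ι → Set (ProjPt k)}
    (h : ∀ i, IsProjectiveVariety (X i)) : IsProjectiveVariety (⋂ i, X i) := by
  choose F _ hF hX using h
  refine .of_homogeneous (⋃ i, F i) (fun g hg => ?_) fun v hv => ?_
  · obtain ⟨i, hi⟩ := Set.mem_iUnion.mp hg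
    exact hF i g hi
  · simp only [Set.mem_iInter, Set.mem_iUnion, hX]
    exact ⟨fun H g ⟨i, hi⟩ => H i g hi, fun H i g hi => H g ⟨i, hi⟩⟩

/-- Elimination of a point `t` of a projective space from equations `A(L t) z = 0`, where `L` runs
over a family of linear maps. -/
theorem IsProjectiveVariety.of_exists_evalAt {l k n d : ℕ} (A : PolyMatrix l k n)
    (hA : ∀ i j, (A i j).IsHomogeneous d) {τ ι : Type*} [Fintype τ]
    (L : ι → (τ → ℂ) →ₗ[ℂ] (Fin n → ℂ)) {V : Set (ProjPt k)}
    (hV : ∀ (v : Fin k → ℂ) (hv : v ≠ 0), Projectivization.mk ℂ v hv ∈ V ↔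
      ∃ t : τ → ℂ, t ≠ 0 ∧ ∀ i, (evalAt A (L i t)).mulVec v = 0) : IsProjectiveVariety V := by
  classical
  -- The unknowns are the coordinates of `t`, the parameters those of `z`: `form i s` is coordinate
  -- `s` of `L i t`, and `f` is a row of `A(L i t) z`.
  let form (i : ι) (s : Fin n) : MvPolynomial τ (MvPolynomial (Fin k) ℂ) :=
    ∑ a, C (C (L i (Pi.single a 1) s)) * X a
  let f (x : ι × Fin l) : MvPolynomial τ (MvPolynomial (Fin k) ℂ) :=
    ∑ j, C (X j) * eval₂ (C.comp C) (form x.1) (A x.2 j)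
  have hform : ∀ i s, (form i s).IsHomogeneous 1 := fun i s =>
    IsHomogeneous.sum _ _ _ fun a _ => isHomogeneous_C_mul_X _ _
  have hf : ∀ x, (f x).IsHomogeneous d := fun x => by
    refine IsHomogeneous.sum _ _ _ fun j _ => IsHomogeneous.C_mul ?_ _
    simpa using (hA x.2 j).eval₂ (C.comp C) (form x.1) (n := 1)
      (fun r => isHomogeneous_C _ _) (hform x.1)
  obtain ⟨G, hG⟩ := exists_eliminants f (fun _ => d) hf
  refine .of_forall_eval_eq_zero G fun v hv => ?_
  rw [hV, ← hG]
  have hval : ∀ (t : τ → ℂ) x, eval t (map (eval v) (f x)) =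
      (evalAt A (L x.1 t)).mulVec v x.2 := by
    intro t x
    have hL : ∀ s, eval t (map (eval v) (form x.1 s)) = L x.1 t s := by
      intro s
      conv_rhs => rw [← Finset.univ_sum_single t, map_sum, Finset.sum_apply]
      simp only [form, map_sum, map_mul, map_C, map_X, eval_C, eval_X]
      refine Finset.sum_congr rfl fun a _ => ?_
      rw [mul_comm, ← smul_eq_mul, ← Pi.smul_apply, ← map_smul, ← Pi.single_smul', smul_eq_mul,
        mul_one]
    simp only [f, map_sum, map_mul, map_C, eval_C, eval_X, Matrix.mulVec, dotProduct, evalAt,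
      Matrix.map_apply]
    refine Finset.sum_congr rfl fun j _ => ?_
    rw [mul_comm]
    congr 1
    change (eval t).comp (map (eval v)) (eval₂ _ _ _) = _
    rw [hom_eval₂]
    simp only [RingHom.comp_apply, hL]
    have hC : ((eval t).comp (map (eval v))).comp (C.comp C) = RingHom.id ℂ := by
      ext1 c
      simp
    rw [hC]
    rfl
  refine exists_congr fun t => and_congr_right fun _ => ?_
  simp only [hval, Prod.forall, _root_.funext_iff, Pi.zero_apply]

end WaveVar

/-! ### Maximal minors and linear independence -/

theorem exists_det_submatrix_ne_zero {K : Type*} [Field K] {m n : ℕ} {S : Matrix (Fin m) (Fin n) K}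
    (hS : LinearIndependent K S.row) : ∃ J : Fin m → Fin n, (S.submatrix id J).det ≠ 0 := by
  obtain ⟨J, hJ⟩ := exists_det_ne_zero_of_span_eq_top S.col (by
    apply Submodule.eq_top_of_finrank_eq
    rw [← Matrix.rank_eq_finrank_span_cols, hS.rank_matrix, Module.finrank_fintype_fun_eq_card])
  refine ⟨J, ?_⟩
  rwa [← Matrix.det_transpose]

theorem injective_of_det_submatrix_ne_zero {R : Type*} [CommRing R] {m n : ℕ}
    {S : Matrix (Fin m) (Fin n) R} {J : Fin m → Fin n} (hJ : (S.submatrix id J).det ≠ 0) :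
    Function.Injective J := by
  intro a b hab
  by_contra hne
  exact hJ (Matrix.det_zero_of_column_eq hne fun i => by simp [hab])

theorem linearIndependent_row_iff_exists_orderEmbedding {K : Type*} [Field K] {m n : ℕ}
    {S : Matrix (Fin m) (Fin n) K} :
    LinearIndependent K S.row ↔ ∃ J : Fin m ↪o Fin n, (S.submatrix id J).det ≠ 0 := by
  constructor
  · intro hS
    obtain ⟨J, hJ⟩ := exists_det_submatrix_ne_zero hS
    have hinj := injective_of_det_submatrix_ne_zero hJ
    -- Sorting the distinct columns changes the minor only by a sign.
    have hmono : StrictMono (J ∘ Tuple.sort J) :=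
      (Tuple.monotone_sort J).strictMono_of_injective (hinj.comp (Tuple.sort J).injective)
    refine ⟨OrderEmbedding.ofStrictMono _ hmono, fun h => hJ ?_⟩
    have := Matrix.det_permute' (Tuple.sort J) (S.submatrix id J)
    rw [Matrix.submatrix_submatrix] at this
    have h' : (S.submatrix (id ∘ id) (J ∘ Tuple.sort J)).det = 0 := h
    rw [h', eq_comm, mul_eq_zero] at this
    refine this.resolve_left ?_
    rcases Int.units_eq_one_or (Equiv.Perm.sign (Tuple.sort J)) with h1 | h1 <;> simp [h1]
  · rintro ⟨J, hJ⟩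
    have h := Matrix.linearIndependent_rows_iff_isUnit.mpr
      ((Matrix.isUnit_iff_isUnit_det _).mpr (isUnit_iff_ne_zero.mpr hJ))
    exact LinearIndependent.of_comp (LinearMap.funLeft K K J) h

/-! ### Obstruction and wave varieties -/

namespace WaveVar

variable {l k n d : ℕ} (A : PolyMatrix l k n)

theorem mk_mem_iUnion_kerAt_iff (hA : ∀ i j, (A i j).IsHomogeneous d)
    (σ : Submodule ℂ (Fin n → ℂ)) (v : Fin k → ℂ) (hv : v ≠ 0) :
    Projectivization.mk ℂ v hv ∈ ⋃ y ∈ points σ, kerAt A y ↔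
      ∃ w ∈ σ, w ≠ 0 ∧ (evalAt A w).mulVec v = 0 := by
  simp only [Set.mem_iUnion, exists_prop]
  constructor
  · rintro ⟨y, hy, h⟩
    induction y using Projectivization.ind with
    | h w hw => exact ⟨w, (mk_mem_points _ _ _).mp hy, hw, (mk_mem_kerAt_mk A hA _ _ _ _).mp h⟩
  · rintro ⟨w, hw, hw0, h⟩
    exact ⟨_, (mk_mem_points _ _ hw0).mpr hw, (mk_mem_kerAt_mk A hA _ _ _ _).mpr h⟩

theorem mk_mem_iInter_kerAt_iff (hA : ∀ i j, (A i j).IsHomogeneous d)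
    {π : Submodule ℂ (Fin n → ℂ)} (hπ : π ≠ ⊥) (v : Fin k → ℂ) (hv : v ≠ 0) :
    Projectivization.mk ℂ v hv ∈ ⋂ y ∈ points π, kerAt A y ↔
      ∀ w ∈ π, (evalAt A w).mulVec v = 0 := by
  simp only [Set.mem_iInter]
  constructor
  · intro h
    have h' : ∀ w ∈ π, w ≠ 0 → (evalAt A w).mulVec v = 0 := fun w hw hw0 =>
      (mk_mem_kerAt_mk A hA _ hw0 _ hv).mp (h _ ((mk_mem_points _ _ hw0).mpr hw))
    intro w hw
    by_cases hw0 : w = 0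
    -- For `d = 0` the matrix at `0` need not vanish; writing `0 = 0 • u` with `u ≠ 0` in `π` covers
    -- every degree.
    · obtain ⟨u, hu, hu0⟩ := Submodule.exists_mem_ne_zero_of_ne_bot hπ
      rw [hw0, ← zero_smul ℂ u, evalAt_smul A hA, Matrix.smul_mulVec, h' u hu hu0, smul_zero]
    · exact h' w hw hw0
  · intro h y hy
    induction y using Projectivization.ind with
    | h w hw => exact (mk_mem_kerAt_mk A hA _ _ _ _).mpr (h w ((mk_mem_points _ _ _).mp hy))

theorem isProjectiveVariety_obstructionVariety (hA : ∀ i j, (A i j).IsHomogeneous d) (r : ℕ) :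
    IsProjectiveVariety (obstructionVariety A r) := by
  refine .iInter fun σ => ?_
  let b := Module.finBasisOfFinrankEq ℂ σ.1 σ.2
  refine .of_exists_evalAt A hA
    (fun _ : Unit => σ.1.subtype ∘ₗ b.equivFun.symm.toLinearMap) fun v hv => ?_
  rw [mk_mem_iUnion_kerAt_iff A hA]
  constructor
  · rintro ⟨w, hw, hw0, h⟩
    refine ⟨b.equivFun ⟨w, hw⟩, ?_, fun _ => by simpa using h⟩
    simpa [-Module.Basis.equivFun_apply] using hw0
  · rintro ⟨t, ht, h⟩
    refine ⟨_, (b.equivFun.symm t).2, ?_, h ()⟩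
    simpa [-Module.Basis.equivFun_symm_apply] using ht

/-- The coordinate of index `J` of an alternating tensor, which is `0` if `J` has a repetition. -/
noncomputable def alternatingCoord {m n : ℕ} (J : Fin m → Fin n) :
    ((Fin m ↪ Fin n) → ℂ) →ₗ[ℂ] ℂ :=
  open Classical in if h : Function.Injective J then LinearMap.proj ⟨J, h⟩ else 0

theorem alternatingCoord_of_injective {m n : ℕ} {J : Fin m → Fin n} (h : Function.Injective J)
    (t : (Fin m ↪ Fin n) → ℂ) : alternatingCoord J t = t ⟨J, h⟩ := by
  simp [alternatingCoord, h]

theorem alternatingCoord_of_not_injective {m n : ℕ} {J : Fin m → Fin n}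
    (h : ¬ Function.Injective J) (t : (Fin m ↪ Fin n) → ℂ) : alternatingCoord J t = 0 := by
  simp [alternatingCoord, h]

theorem alternatingCoord_update {m n : ℕ} (I : Fin m ↪ Fin n) (a b : Fin m)
    (t : (Fin m ↪ Fin n) → ℂ) :
    alternatingCoord (Function.update I a (I b)) t = if a = b then t I else 0 := by
  split_ifs with h
  · subst h
    rw [Function.update_eq_self, alternatingCoord_of_injective I.injective]
    rfl
  · refine alternatingCoord_of_not_injective (fun hinj => h ?_) t
    exact hinj (by simp [Function.update_of_ne (Ne.symm h)])

/-- The contraction of an alternating tensor to a vector; for a decomposable tensor it lies in the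
subspace that the tensor represents. -/
noncomputable def contraction {m n : ℕ} (x : (Fin m → Fin n) × (Fin m → ℂ)) :
    ((Fin m ↪ Fin n) → ℂ) →ₗ[ℂ] (Fin n → ℂ) :=
  LinearMap.pi fun j => ∑ a, x.2 a • alternatingCoord (Function.update x.1 a j)

theorem contraction_apply {m n : ℕ} (x : (Fin m → Fin n) × (Fin m → ℂ)) (t : (Fin m ↪ Fin n) → ℂ) :
    contraction x t = ∑ a, x.2 a • fun j => alternatingCoord (Function.update x.1 a j) t := by
  ext j
  simp [contraction, Finset.sum_apply]

/-- If `t I ≠ 0`, the `m` vectors got by freeing one index of `I` restrict on the coordinates in `I`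
to `t I` times the identity, hence are independent. Only vanishing on repeated indices matters;
antisymmetry is not needed. -/
theorem exists_gr_forall_mem_exists_contraction {m n : ℕ} {t : (Fin m ↪ Fin n) → ℂ} (ht : t ≠ 0) :
    ∃ π : Gr m n, ∀ w ∈ π.1, ∃ x, contraction x t = w := by
  obtain ⟨I, hI⟩ := Function.ne_iff.mp ht
  let s : Fin m → Fin n → ℂ := fun a j => alternatingCoord (Function.update I a j) t
  have hs : LinearIndependent ℂ s := by
    rw [Fintype.linearIndependent_iff]
    intro g hg b
    have := congrFun hg (I b)
    simp only [Finset.sum_apply, Pi.smul_apply, s, alternatingCoord_update, smul_eq_mul,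
      mul_ite, mul_zero, Finset.sum_ite_eq', Finset.mem_univ, if_true, Pi.zero_apply] at this
    exact (mul_eq_zero.mp this).resolve_right hI
  refine ⟨⟨Submodule.span ℂ (Set.range s), by simpa using finrank_span_eq_card hs⟩, fun w hw => ?_⟩
  obtain ⟨c, rfl⟩ := (Submodule.mem_span_range_iff_exists_fun ℂ).mp hw
  exact ⟨(I, c), contraction_apply _ _⟩

theorem exists_ne_zero_forall_contraction_mem {m n : ℕ} (π : Gr m n) :
    ∃ t : (Fin m ↪ Fin n) → ℂ, t ≠ 0 ∧ ∀ x, contraction x t ∈ π.1 := by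
  let b := Module.finBasisOfFinrankEq ℂ π.1 π.2
  let S : Matrix (Fin m) (Fin n) ℂ := Matrix.of fun a => (b a : Fin n → ℂ)
  have hS : LinearIndependent ℂ S.row :=
    b.linearIndependent.map' π.1.subtype (Submodule.ker_subtype _)
  let t : (Fin m ↪ Fin n) → ℂ := fun J => (S.submatrix id J).det
  have ht : ∀ J, alternatingCoord J t = (S.submatrix id J).det := by
    intro J
    by_cases hJ : Function.Injective J
    · rw [alternatingCoord_of_injective hJ]
      rfl
    · rw [alternatingCoord_of_not_injective hJ]
      by_contra h
      exact hJ (injective_of_det_submatrix_ne_zero (Ne.symm h))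
  refine ⟨t, ?_, fun x => ?_⟩
  · obtain ⟨J, hJ⟩ := exists_det_submatrix_ne_zero hS
    exact Function.ne_iff.mpr ⟨⟨J, injective_of_det_submatrix_ne_zero hJ⟩, hJ⟩
  · rw [contraction_apply]
    refine Submodule.sum_mem _ fun a _ => Submodule.smul_mem _ _ ?_
    -- Cramer's rule: a minor is linear in its column `a`, with coefficients from the adjugate that
    -- do not depend on `j`.
    have : (fun j => alternatingCoord (Function.update x.1 a j) t) =
        ∑ c, (S.submatrix id x.1).adjugate a c • (b c : Fin n → ℂ) := by
      funext j
      have h : S.submatrix id (Function.update x.1 a j) =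
          (S.submatrix id x.1).updateCol a (fun i => S i j) := by
        ext i c
        by_cases hc : c = a
        · subst hc; simp
        · simp [hc]
      rw [ht, h, ← Matrix.cramer_apply, Matrix.cramer_eq_adjugate_mulVec]
      simp [Matrix.mulVec, dotProduct, Finset.sum_apply, S]
    rw [this]
    exact Submodule.sum_mem _ fun c _ => Submodule.smul_mem _ _ (b c).2

theorem isProjectiveVariety_waveVariety (hA : ∀ i j, (A i j).IsHomogeneous d) {r : ℕ}
    (hr : r < n) : IsProjectiveVariety (waveVariety A r) := by
  refine .of_exists_evalAt A hA (contraction (m := n - r) (n := n)) fun v hv => ?_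
  have hbot : ∀ π : Gr (n - r) n, π.1 ≠ ⊥ := fun π h => by
    have := π.2
    rw [h, finrank_bot] at this
    omega
  simp only [waveVariety, Set.mem_iUnion (s := fun π : Gr (n - r) n => ⋂ y ∈ points π.1, kerAt A y),
    mk_mem_iInter_kerAt_iff A hA (hbot _)]
  constructor
  · rintro ⟨π, h⟩
    obtain ⟨t, ht, hπ⟩ := exists_ne_zero_forall_contraction_mem π
    exact ⟨t, ht, fun x => h _ (hπ x)⟩
  · rintro ⟨t, ht, h⟩
    obtain ⟨π, hπ⟩ := exists_gr_forall_mem_exists_contraction ht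
    refine ⟨π, fun w hw => ?_⟩
    obtain ⟨x, rfl⟩ := hπ w hw
    exact h x

/-! ### Equations of the incidence variety -/

section Incidence

variable {m : ℕ}

/-- The polynomials that express `A(y) z = 0`. -/
noncomputable def kernelEquation (m : ℕ) (i : Fin l) :
    MvPolynomial (Fin n ⊕ Fin k ⊕ (Fin m ↪o Fin n)) ℂ :=
  ∑ j, rename Sum.inl (A i j) * X (Sum.inr (Sum.inl j))

/-- The bilinear polynomials in `y` and the Plücker coordinates of `π` that express `y ∈ π`. -/
noncomputable def membershipEquation (k : ℕ) (K : Fin (m + 1) ↪o Fin n) :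
    MvPolynomial (Fin n ⊕ Fin k ⊕ (Fin m ↪o Fin n)) ℂ :=
  ∑ s : Fin (m + 1), C ((-1) ^ (s : ℕ)) *
    (X (Sum.inl (K s)) * X (Sum.inr (Sum.inr ((Fin.succAboveOrderEmb s).trans K))))

theorem isWeightedHomogeneous_kernelEquation (hA : ∀ i j, (A i j).IsHomogeneous d) (i : Fin l) :
    (kernelEquation A m i).IsWeightedHomogeneous triWeight (d, 1, 0) := by
  refine IsWeightedHomogeneous.sum _ _ _ fun j _ => ?_
  rw [show ((d, 1, 0) : ℕ × ℕ × ℕ) = (d, 0, 0) + (0, 1, 0) by simp]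
  refine IsWeightedHomogeneous.mul ?_ (isWeightedHomogeneous_X ℂ triWeight _)
  rw [(A i j).as_sum, map_sum]
  refine IsWeightedHomogeneous.sum _ _ _ fun a ha => ?_
  rw [rename_monomial]
  refine isWeightedHomogeneous_monomial _ _ _ ?_
  rw [Finsupp.weight_apply, Finsupp.sum_mapDomain_index (by simp) (by simp [add_smul]),
    (hA i j).degree_eq_sum_deg_support ha]
  simp [triWeight, Finsupp.sum, Prod.ext_iff, Prod.fst_sum, Prod.snd_sum]

theorem isWeightedHomogeneous_membershipEquation (K : Fin (m + 1) ↪o Fin n) :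
    (membershipEquation k K).IsWeightedHomogeneous triWeight (1, 0, 1) := by
  refine IsWeightedHomogeneous.sum _ _ _ fun s _ => IsWeightedHomogeneous.C_mul ?_ _
  exact (isWeightedHomogeneous_X ℂ triWeight _).mul (isWeightedHomogeneous_X ℂ triWeight _)

theorem eval_kernelEquation (i : Fin l) (v : Fin n → ℂ) (w : Fin k → ℂ)
    (p : (Fin m ↪o Fin n) → ℂ) :
    eval (Sum.elim v (Sum.elim w p)) (kernelEquation A m i) = (evalAt A v).mulVec w i := by
  simp [kernelEquation, Matrix.mulVec, dotProduct, evalAt, eval_rename]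

/-- Laplace expansion along the top row `v`. -/
theorem eval_membershipEquation (K : Fin (m + 1) ↪o Fin n) (v : Fin n → ℂ) (w : Fin k → ℂ)
    (S : Matrix (Fin m) (Fin n) ℂ) :
    eval (Sum.elim v (Sum.elim w fun I : Fin m ↪o Fin n => (S.submatrix id I).det))
      (membershipEquation k K) =
      ((Matrix.of (Fin.cons v S.row : Fin (m + 1) → Fin n → ℂ)).submatrix id K).det := by
  rw [Matrix.det_succ_row_zero]
  simp only [membershipEquation, map_sum, map_mul, eval_C, eval_X, Sum.elim_inl, Sum.elim_inr]
  refine Finset.sum_congr rfl fun s _ => ?_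
  rw [mul_assoc]
  rfl

theorem isTriprojectiveVariety_incidence (hA : ∀ i j, (A i j).IsHomogeneous d) (m : ℕ) :
    IsTriprojectiveVariety (incidence A m) := by
  refine ⟨Set.range (kernelEquation A m) ∪ Set.range (membershipEquation k),
    (Set.finite_range _).union (Set.finite_range _), ?_, ?_⟩
  · rintro _ (⟨i, rfl⟩ | ⟨K, rfl⟩)
    · exact ⟨_, isWeightedHomogeneous_kernelEquation A hA i⟩
    · exact ⟨_, isWeightedHomogeneous_membershipEquation K⟩
  · rintro v hv w hw π p ⟨S, hS, hp⟩
    obtain rfl : p = fun I : Fin m ↪o Fin n => (S.submatrix id I).det := funext hp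
    have hli : LinearIndependent ℂ S.row := by
      rw [linearIndependent_iff_card_eq_finrank_span, Fintype.card_fin]
      exact π.2.symm.trans (by rw [← hS]; rfl)
    -- The rows of `S` are independent, so `v ∈ π` iff putting `v` on top makes the rows dependent.
    have hmem : v ∈ π.1 ↔ ∀ K : Fin (m + 1) ↪o Fin n,
        ((Matrix.of (Fin.cons v S.row : Fin (m + 1) → Fin n → ℂ)).submatrix id K).det = 0 := by
      have h1 : LinearIndependent ℂ (Fin.cons v S.row : Fin (m + 1) → Fin n → ℂ) ↔ v ∉ π.1 := by
        have hS' : Submodule.span ℂ (Set.range S.row) = π.1 := hS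
        rw [linearIndependent_finCons, hS']
        exact and_iff_right hli
      have h2 := linearIndependent_row_iff_exists_orderEmbedding
        (S := Matrix.of (Fin.cons v S.row : Fin (m + 1) → Fin n → ℂ))
      rw [← not_iff_not, ← h1]
      push Not
      exact h2
    have hker : (evalAt A v).mulVec w = 0 ↔ ∀ i, (evalAt A v).mulVec w i = 0 :=
      _root_.funext_iff
    simp only [Set.mem_union, or_imp, forall_and, Set.forall_mem_range, eval_kernelEquation,
      eval_membershipEquation, ← hmem, ← hker]
    exact and_congr (mk_mem_kerAt_mk A hA v hv w hw) (mk_mem_points _ _ _)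

end Incidence

end WaveVar

theorem mainTheorem6 (n k l d : ℕ) (A : WaveVar.PolyMatrix l k n)
    (hA : ∀ i j, (A i j).IsHomogeneous d) :
    (∀ r : ℕ, r < n → WaveVar.IsProjectiveVariety (WaveVar.waveVariety A r)) ∧
    (∀ r : ℕ, 1 ≤ r → r ≤ n →
      WaveVar.IsProjectiveVariety (WaveVar.obstructionVariety A r)) ∧
    (∀ m : ℕ, 1 ≤ m → m ≤ n → WaveVar.IsTriprojectiveVariety (WaveVar.incidence A m)) ∧
    (∀ r : ℕ, r < n → WaveVar.waveVariety A r =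
      {z | ∃ π : WaveVar.Gr (n - r) n, ∀ y ∈ WaveVar.points π.1,
        (y, z, π) ∈ WaveVar.incidence A (n - r)}) ∧
    (∀ r : ℕ, 1 ≤ r → r ≤ n → WaveVar.obstructionVariety A r =
      {z | ∀ σ : WaveVar.Gr r n, ∃ y : WaveVar.ProjPt n,
        (y, z, σ) ∈ WaveVar.incidence A r}) := by
  refine ⟨fun r hr => WaveVar.isProjectiveVariety_waveVariety A hA hr,
    fun r _ _ => WaveVar.isProjectiveVariety_obstructionVariety A hA r,
    fun m _ _ => WaveVar.isTriprojectiveVariety_incidence A hA m, fun r _ => ?_, fun r _ _ => ?_⟩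
  · ext z
    refine Set.mem_iUnion.trans (exists_congr fun π => ?_)
    simp only [Set.mem_iInter]
    exact forall₂_congr fun y hy => (and_iff_left hy).symm
  · ext z
    refine Set.mem_iInter.trans (forall_congr' fun σ => ?_)
    simp only [Set.mem_iUnion, exists_prop]
    exact exists_congr fun y => and_comm
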